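/- Let $S\in\mathbb{R}^{q\times q}$ be a matrix whose (complex) eigenvalues are all distinct and have zero real part, and let $v:[0,\infty)\to\mathbb{R}^q$ satisfy $\dot v=Sv$ (the leader). Let $\bar{\mathcal G}_1,\dots,\bar{\mathcal G}_{n_0}$ be digraphs on the nodes $\{0,1,\dots,N\}$ (node $0$ is the leader, nodes $1,\dots,N$ are the followers) with weighted adjacency matrices $\bar{\mathcal A}_p=[\bar a^{p}_{ij}]$, that is, $\bar a^p_{ii}=0$, $\bar a^p_{ij}\ge 0$, and $\bar a^p_{ij}>0$ if and only if $(j,i)$ is an edge of $\bar{\mathcal G}_p$. Let $\sigma:[0,\infty)\to\{1,\dots,n_0\}$ be a switching signal that is constant on each $[t_i,t_{i+1})$, where $0=t_0<t_1<t_2<\cdots$ and $t_{i+1}-t_i\ge\tau_0$ for all $i\ge 0$ and some constant $\tau_0>0$. Put $\bar a_{ij}(t)=\bar a^{\sigma(t)}_{ij}$. Assume that there are a subsequence $\{i_k\}$ of $\{0,1,2,\dots\}$ and an $\epsilon>0$ such that, for all $k$, $t_{i_{k+1}}-t_{i_k}<\epsilon$ and the union digraph $\bigcup_{j=i_k}^{i_{k+1}-1}\bar{\mathcal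 G}_{\sigma(t_j)}$ contains a directed spanning tree with root $0$. Let $\mu_1,\mu_2>0$, let $\hat S_0=S$ and $\hat v_0=v$, and let $\hat S_i(t)\in\mathbb{R}^{q\times q}$, $\hat v_i(t)\in\mathbb{R}^q$, $i=1,\dots,N$, be any solution on $[0,\infty)$ (continuous, and satisfying the equations between consecutive instants $t_k$), with arbitrary initial conditions, of the adaptive distributed observer $$\dot{\hat S}_i=\mu_1\sum_{j=0}^N\bar a_{ij}(t)(\hat S_j-\hat S_i),\qquad \dot{\hat v}_i=\hat S_i\hat v_i+\mu_2\sum_{j=0}^N\bar a_{ij}(t)(\hat v_j-\hat v_i),\qquad i=1,\dots,N.$$ Let $\tilde S=\mathrm{col}(\hat S_1-S,\dots,\hat S_N-S)\in\mathbb{R}^{Nq\times q}$ and $\tilde v=\mathrm{col}(\hat v_1-v,\dots,\hat v_N-v)\in\mathbb{R}^{Nq}$. Then: 1. $\tilde S(t)\to 0$ exponentially as $t\to+\infty$; 2. $\tilde v(t)\to 0$ exponentially as $t\to+\infty$. Here $f(t)\to0$ exponentially means that there are constants $c,\lambda>0$ with $\|f(t)\|\le c\,e^{-\lambda t}$ for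 all $t\ge0$; $\|\cdot\|$ is the Euclidean norm for vectors and the norm induced by it for matrices. -/

import Mathlib

open scoped Matrix

/-- All (complex) eigenvalues of the real matrix `S` are distinct and have zero real part;
the eigenvalues are counted with algebraic multiplicity. -/
def HasDistinctImaginaryEigenvalues {q : ℕ} (S : Matrix (Fin q) (Fin q) ℝ) : Prop :=
  (S.map (algebraMap ℝ ℂ)).charpoly.roots.Nodup ∧
    ∀ z ∈ (S.map (algebraMap ℝ ℂ)).charpoly.roots, z.re = 0

/-- `A = [a i j]` is a weighted adjacency matrix of the digraph `G`: it is nonnegative with zero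
diagonal, and `a i j > 0` exactly when there is an edge from `j` to `i`. -/
structure IsWeightedAdjacency {V : Type*} (G : Digraph V) (A : Matrix V V ℝ) : Prop where
  diag_eq_zero : ∀ i, A i i = 0
  nonneg : ∀ i j, 0 ≤ A i j
  pos_iff : ∀ i j, 0 < A i j ↔ G.Adj j i

/-- `T` is a directed tree with root `r`: the root has no parent, every other node has exactly one
parent, and every other node is reachable from the root along a directed path. -/
structure IsDirectedTree {V : Type*} (T : Digraph V) (r : V) : Prop where
  root_no_parent : ∀ i, ¬ T.Adj i r
  unique_parent : ∀ j, j ≠ r → ∃! i, T.Adj i j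
  reachable : ∀ j, j ≠ r → Relation.TransGen T.Adj r j

/-- The digraph `G` contains a directed spanning tree with root `r`
(`T ≤ G` says that `T` has the same nodes as `G` and that its edges are edges of `G`). -/
def ContainsDirectedSpanningTree {V : Type*} (G : Digraph V) (r : V) : Prop :=
  ∃ T : Digraph V, T ≤ G ∧ IsDirectedTree T r

/-- `σ` (on `[0, ∞)`) is a piecewise constant switching signal with switching instants
`0 = t 0 < t 1 < ⋯` and a positive dwell time. It is allowed not to jump at some `t k`. -/
structure IsSwitchingSignal {n₀ : ℕ} (σ : ℝ → Fin n₀) (t : ℕ → ℝ) : Prop where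
  zero : t 0 = 0
  dwell : ∃ τ₀ > 0, ∀ k, τ₀ ≤ t (k + 1) - t k
  const : ∀ k, ∀ s ∈ Set.Ico (t k) (t (k + 1)), σ s = σ (t k)

/-- Joint connectivity of the switching digraph `G (σ s)` with root `r`: along a subsequence
`t (i k)` of the switching instants with bounded gaps, each union graph
`⋃_{j = i k}^{i (k + 1) - 1} G (σ (t j))` contains a directed spanning tree with root `r`. -/
def JointlyConnected {V : Type*} {n₀ : ℕ} (G : Fin n₀ → Digraph V) (σ : ℝ → Fin n₀) (t : ℕ → ℝ)
    (r : V) : Prop :=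
  ∃ i : ℕ → ℕ, StrictMono i ∧
    (∃ ε > 0, ∀ k, t (i (k + 1)) - t (i k) < ε) ∧
    ∀ k, ContainsDirectedSpanningTree (⨆ j ∈ Set.Ico (i k) (i (k + 1)), G (σ (t j))) r

/-- `v` is a trajectory on `[0, ∞)` of the leader system `v' = S v`. -/
def IsLeaderTrajectory {q : ℕ} (S : Matrix (Fin q) (Fin q) ℝ) (v : ℝ → Fin q → ℝ) : Prop :=
  ∀ s, 0 ≤ s → HasDerivWithinAt v (S *ᵥ v s) (Set.Ici 0) s

/-- `(Shat, vhat)` is a solution on `[0, ∞)` of the adaptive distributed observer. Node `0` is the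
leader and the nodes `i.succ`, `i : Fin N`, are the followers. Solutions are continuous on `[0, ∞)`
and satisfy the differential equations between consecutive switching instants. -/
structure IsAdaptiveObserver {N q n₀ : ℕ} (S : Matrix (Fin q) (Fin q) ℝ) (v : ℝ → Fin q → ℝ)
    (A : Fin n₀ → Matrix (Fin (N + 1)) (Fin (N + 1)) ℝ) (σ : ℝ → Fin n₀) (t : ℕ → ℝ) (μ₁ μ₂ : ℝ)
    (Shat : Fin (N + 1) → ℝ → Matrix (Fin q) (Fin q) ℝ)
    (vhat : Fin (N + 1) → ℝ → Fin q → ℝ) : Prop where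
  leader_S : ∀ s, 0 ≤ s → Shat 0 s = S
  leader_v : ∀ s, 0 ≤ s → vhat 0 s = v s
  continuousOn_S : ∀ i : Fin N, ContinuousOn (Shat i.succ) (Set.Ici 0)
  continuousOn_v : ∀ i : Fin N, ContinuousOn (vhat i.succ) (Set.Ici 0)
  hasDerivAt_S : ∀ (i : Fin N) (k : ℕ), ∀ s ∈ Set.Ioo (t k) (t (k + 1)),
    HasDerivAt (Shat i.succ)
      (μ₁ • ∑ j, A (σ s) i.succ j • (Shat j s - Shat i.succ s)) s
  hasDerivAt_v : ∀ (i : Fin N) (k : ℕ), ∀ s ∈ Set.Ioo (t k) (t (k + 1)),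
    HasDerivAt (vhat i.succ)
      (Shat i.succ s *ᵥ vhat i.succ s
        + μ₂ • ∑ j, A (σ s) i.succ j • (vhat j s - vhat i.succ s)) s

/-- The stacked error `col(Shat 1 - S, …, Shat N - S)`, an `Nq × q` matrix. -/
def errorS {N q : ℕ} (S : Matrix (Fin q) (Fin q) ℝ)
    (Shat : Fin (N + 1) → ℝ → Matrix (Fin q) (Fin q) ℝ) (s : ℝ) :
    Matrix (Fin N × Fin q) (Fin q) ℝ :=
  Matrix.of fun p b => (Shat p.1.succ s - S) p.2 b

/-- The stacked error `col(vhat 1 - v, …, vhat N - v)`, a Euclidean vector of dimension `Nq`. -/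
def errorV {N q : ℕ} (v : ℝ → Fin q → ℝ) (vhat : Fin (N + 1) → ℝ → Fin q → ℝ) (s : ℝ) :
    EuclideanSpace ℝ (Fin N × Fin q) :=
  WithLp.toLp 2 fun p => (vhat p.1.succ s - v s) p.2

/-- `f s` converges to zero exponentially as `s → ∞`. -/
def ExponentiallyTendsToZero {E : Type*} [Norm E] (f : ℝ → E) : Prop :=
  ∃ c > 0, ∃ r > 0, ∀ s, 0 ≤ s → ‖f s‖ ≤ c * Real.exp (-r * s)

open scoped Matrix.Norms.L2Operator

/-! Both errors reduce to scalar consensus with the leader fixed at 0, `x i' = ∑ j, W i j * (x j - x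
i) + d i`. For the entries of `Shat i - S` there is no perturbation. For `vhat i - v`, take
left-eigenvector coordinates of `S` and multiply by `exp (-z s)`: since `z` is imaginary, moduli are
unchanged and the `S`-term cancels. What remains of `d` comes from `(Shat i - S) vhat i`, an
exponentially decaying multiple of the error plus the bounded leader.

Consensus contracts because positivity spreads. If all `x i ≤ M` at some time, with `M ≥ 0`, the
gaps `M - x i`, corrected for the perturbation, form a nonnegative supersolution whose leader value
is at least `M`. In each window, while some node is unreached, an edge leaves the set of nodes with
a known lower bound and stays active for a dwell time, so this set grows (`exists_reached_succ`);
after `N` windows every corrected gap is at least `η * M`. Used for `x` and `-x`, this shrinks `max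
|x i|` by the factor `1 - η` up to an exponentially small term
(`IsPerturbedConsensus.exists_exp_bound`). When the perturbation depends on the solution,
`exists_exp_bound_family` first proves boundedness by absorbing a small tail. -/

open Set Filter

/-! ### Comparison for functions differentiable off the switching instants -/

namespace IsSwitchingSignal

variable {n₀ : ℕ} {σ : ℝ → Fin n₀} {t : ℕ → ℝ}

lemma strictMono (hσ : IsSwitchingSignal σ t) : StrictMono t := by
  obtain ⟨τ, hτ, h⟩ := hσ.dwell
  exact strictMono_nat_of_lt_succ fun k => by linarith [h k]

lemma nonneg (hσ : IsSwitchingSignal σ t) (k : ℕ) : 0 ≤ t k :=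
  hσ.zero ▸ hσ.strictMono.monotone (Nat.zero_le k)

lemma exists_le (hσ : IsSwitchingSignal σ t) (b : ℝ) : ∃ n, b ≤ t n := by
  obtain ⟨τ, hτ, h⟩ := hσ.dwell
  have key : ∀ n : ℕ, n * τ ≤ t n := by
    intro n
    induction n with
    | zero => simp [hσ.zero]
    | succ n ih => push_cast; linarith [h n]
  obtain ⟨n, hn⟩ := exists_nat_ge (b / τ)
  exact ⟨n, ((div_le_iff₀ hτ).1 hn).trans (key n)⟩

/-- A continuous function whose derivative is nonnegative between the switching instants is
nondecreasing. -/
lemma le_of_deriv_nonneg (hσ : IsSwitchingSignal σ t) {f : ℝ → ℝ} {a b : ℝ} (ha : 0 ≤ a)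
    (hab : a ≤ b) (hf : ContinuousOn f (Icc a b))
    (hd : ∀ k, ∀ s ∈ Ioo (t k) (t (k + 1)), a < s → s < b → ∃ f', HasDerivAt f f' s ∧ 0 ≤ f') :
    f a ≤ f b := by
  -- Induction over the switching intervals: monotonicity holds inside each one, and continuity
  -- glues them.
  have key : ∀ n : ℕ, ∀ c, a ≤ c → c ≤ b → c ≤ t n → f a ≤ f c := by
    intro n
    induction n with
    | zero =>
      intro c hac _ hc
      rw [hσ.zero] at hc
      rw [show a = c by linarith]
    | succ n ih =>
      intro c hac hcb hc
      rcases le_total c (t n) with h | h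
      · exact ih c hac hcb h
      · have step : ∀ e, a ≤ e → t n ≤ e → e ≤ c → f e ≤ f c := by
          intro e hae hne hec
          have hm : MonotoneOn f (Icc e c) := by
            have hex : ∀ s ∈ interior (Icc e c), ∃ f', HasDerivAt f f' s ∧ 0 ≤ f' := by
              intro s hs
              rw [interior_Icc] at hs
              exact hd n s ⟨hne.trans_lt hs.1, hs.2.trans_le hc⟩ (hae.trans_lt hs.1)
                (hs.2.trans_le hcb)
            refine monotoneOn_of_deriv_nonneg (convex_Icc e c)
              (hf.mono (Icc_subset_Icc hae hcb)) ?_ ?_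
            · intro s hs
              obtain ⟨f', h1, -⟩ := hex s hs
              exact h1.differentiableAt.differentiableWithinAt
            · intro s hs
              obtain ⟨f', h1, h2⟩ := hex s hs
              rwa [h1.deriv]
          exact hm (left_mem_Icc.2 hec) (right_mem_Icc.2 hec) hec
        rcases le_total a (t n) with h' | h'
        · exact (ih (t n) h' (h.trans hcb) le_rfl).trans (step (t n) h' le_rfl h)
        · exact step a le_rfl h' hac
  obtain ⟨n, hn⟩ := hσ.exists_le b
  exact key n b hab le_rfl hn

/-- Comparison with the linear equation `f' = K (γ - f)`. -/
lemma lower_bound_of_deriv (hσ : IsSwitchingSignal σ t) {f : ℝ → ℝ} {a b K γ : ℝ} (ha : 0 ≤ a)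
    (hab : a ≤ b) (hf : ContinuousOn f (Icc a b))
    (hd : ∀ k, ∀ s ∈ Ioo (t k) (t (k + 1)), a < s → s < b →
      ∃ f', HasDerivAt f f' s ∧ K * (γ - f s) ≤ f') :
    γ + Real.exp (-K * (b - a)) * (f a - γ) ≤ f b := by
  -- Integrating factor `exp (K s)`.
  have h := hσ.le_of_deriv_nonneg (f := fun s => Real.exp (K * s) * (f s - γ)) ha hab
    (by fun_prop) (by
      intro k s hs has hsb
      obtain ⟨f', h1, h2⟩ := hd k s hs has hsb
      have he : HasDerivAt (fun s => Real.exp (K * s)) (Real.exp (K * s) * K) s := by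
        simpa using ((hasDerivAt_id s).const_mul K).exp
      refine ⟨_, he.mul (h1.sub_const γ), ?_⟩
      have : 0 ≤ Real.exp (K * s) * (f' - K * (γ - f s)) :=
        mul_nonneg (Real.exp_pos _).le (by linarith)
      linarith)
  have h2 := mul_le_mul_of_nonneg_left h (Real.exp_pos (-(K * b))).le
  simp only [← mul_assoc, ← Real.exp_add] at h2
  rw [show -(K * b) + K * a = -K * (b - a) by ring, show -(K * b) + K * b = 0 by ring,
    Real.exp_zero] at h2
  linarith

end IsSwitchingSignal

/-! ### Supersolutions of the consensus equation -/

/-- On `[a, b]` the functions `u i` satisfy the differential inequality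
`u i' ≥ ∑ j, W i j * (u j - u i)` for every follower `i`, between the switching instants `t k`. -/
structure IsConsensusSupersolution {N : ℕ} (W : ℝ → Matrix (Fin (N + 1)) (Fin (N + 1)) ℝ)
    (t : ℕ → ℝ) (a b : ℝ) (u : Fin (N + 1) → ℝ → ℝ) : Prop where
  continuousOn : ∀ i : Fin N, ContinuousOn (u i.succ) (Icc a b)
  deriv_ge : ∀ (i : Fin N) (k : ℕ), ∀ s ∈ Ioo (t k) (t (k + 1)), a < s → s < b →
    ∃ u', HasDerivAt (u i.succ) u' s ∧ ∑ j, W s i.succ j * (u j s - u i.succ s) ≤ u'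

/-- The weights `W` are nonnegative with row sums at most `K`. -/
structure HasBoundedWeights {N : ℕ} (W : ℝ → Matrix (Fin (N + 1)) (Fin (N + 1)) ℝ) (K : ℝ) :
    Prop where
  nonneg : ∀ s i j, 0 ≤ W s i j
  sum_le : ∀ s i, ∑ j, W s i j ≤ K

namespace IsConsensusSupersolution

variable {N n₀ : ℕ} {σ : ℝ → Fin n₀} {t : ℕ → ℝ}
  {W : ℝ → Matrix (Fin (N + 1)) (Fin (N + 1)) ℝ} {K a b : ℝ} {u : Fin (N + 1) → ℝ → ℝ}

lemma mono (hu : IsConsensusSupersolution W t a b u) {a' b' : ℝ} (ha : a ≤ a') (hb : b' ≤ b) :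
    IsConsensusSupersolution W t a' b' u where
  continuousOn i := (hu.continuousOn i).mono (Icc_subset_Icc ha hb)
  deriv_ge i k s hs h1 h2 := hu.deriv_ge i k s hs (ha.trans_lt h1) (h2.trans_le hb)

/-- Minimum principle. -/
lemma nonneg (hu : IsConsensusSupersolution W t a b u) (hσ : IsSwitchingSignal σ t)
    (hW : HasBoundedWeights W K) (ha : 0 ≤ a)
    (h0 : ∀ s ∈ Icc a b, 0 ≤ u 0 s) (hinit : ∀ i : Fin N, 0 ≤ u i.succ a) :
    ∀ i, ∀ s ∈ Icc a b, 0 ≤ u i s := by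
  intro i s hs
  have hab : a ≤ b := hs.1.trans hs.2
  induction i using Fin.cases with
  | zero => exact h0 s hs
  | succ i =>
  have hN : Nonempty (Fin N) := ⟨i⟩
  choose m hm hmin using fun i : Fin N =>
    isCompact_Icc.exists_isMinOn (nonempty_Icc.2 hab) (hu.continuousOn i)
  obtain ⟨i₁, hi₁⟩ := Finite.exists_min fun i : Fin N => u i.succ (m i)
  set P := u i₁.succ (m i₁) with hP
  have hge : ∀ (j : Fin N), ∀ τ ∈ Icc a b, P ≤ u j.succ τ := fun j τ hτ =>
    (hi₁ j).trans (hmin j hτ)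
  suffices 0 ≤ P from this.trans (hge i s hs)
  by_contra hneg
  push Not at hneg
  have hge' : ∀ j, ∀ τ ∈ Icc a b, P ≤ u j τ := by
    intro j τ hτ
    induction j using Fin.cases with
    | zero => exact hneg.le.trans (h0 τ hτ)
    | succ j => exact hge j τ hτ
  -- Let `P < 0` be the minimum over all followers and times. Up to the minimizing time, `u' ≥ K *
  -- (P - u)`, so starting strictly above `P` the function cannot reach `P` in finite time.
  have hb := hσ.lower_bound_of_deriv (f := u i₁.succ) (K := K) (γ := P) ha (hm i₁).1
    ((hu.continuousOn i₁).mono (Icc_subset_Icc le_rfl (hm i₁).2)) (by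
      intro k τ hτ h1 h2
      have hτ' : τ ∈ Icc a b := ⟨h1.le, h2.le.trans (hm i₁).2⟩
      obtain ⟨u', hd, hle⟩ := hu.deriv_ge i₁ k τ hτ h1 (h2.trans_le (hm i₁).2)
      refine ⟨u', hd, le_trans ?_ hle⟩
      calc K * (P - u i₁.succ τ)
          ≤ (∑ j, W τ i₁.succ j) * (P - u i₁.succ τ) :=
            mul_le_mul_of_nonpos_right (hW.sum_le _ _) (by linarith [hge i₁ τ hτ'])
        _ = ∑ j, W τ i₁.succ j * (P - u i₁.succ τ) := Finset.sum_mul ..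
        _ ≤ _ := Finset.sum_le_sum fun j _ =>
            mul_le_mul_of_nonneg_left (by linarith [hge' j τ hτ']) (hW.nonneg _ _ _))
  rw [← hP] at hb
  have := mul_pos (Real.exp_pos (-K * (m i₁ - a)))
    (show 0 < u i₁.succ a - P by linarith [hinit i₁])
  linarith

variable (hu : IsConsensusSupersolution W t a b u) (hσ : IsSwitchingSignal σ t)
  (hW : HasBoundedWeights W K) (ha : 0 ≤ a) (hpos : ∀ i, ∀ s ∈ Icc a b, 0 ≤ u i s)

include hu hσ hW ha hpos

/-- Discarding the nonnegative inflow from the neighbours leaves `u' ≥ -K * u`: a lower bound once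
acquired is lost at rate at most `K`. -/
lemma exp_mul_le {c d : ℝ} (hac : a ≤ c) (hcd : c ≤ d) (hdb : d ≤ b) (i : Fin N) :
    Real.exp (-K * (d - c)) * u i.succ c ≤ u i.succ d := by
  have := hσ.lower_bound_of_deriv (f := u i.succ) (K := K) (γ := 0) (ha.trans hac) hcd
    ((hu.continuousOn i).mono (Icc_subset_Icc hac hdb)) (by
      intro k τ hτ h1 h2
      have hτ' : τ ∈ Icc a b := ⟨hac.trans h1.le, h2.le.trans hdb⟩
      obtain ⟨u', hd, hle⟩ := hu.deriv_ge i k τ hτ (hac.trans_lt h1) (h2.trans_le hdb)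
      refine ⟨u', hd, le_trans ?_ hle⟩
      calc K * (0 - u i.succ τ)
          ≤ (∑ j, W τ i.succ j) * (0 - u i.succ τ) :=
            mul_le_mul_of_nonpos_right (hW.sum_le _ _) (by linarith [hpos i.succ τ hτ'])
        _ = ∑ j, W τ i.succ j * (0 - u i.succ τ) := Finset.sum_mul ..
        _ ≤ _ := Finset.sum_le_sum fun j _ =>
            mul_le_mul_of_nonneg_left (by linarith [hpos j τ hτ']) (hW.nonneg _ _ _))
  simpa using this

/-- A single active edge gives `u' ≥ α * B - K * u`, which pulls `u` towards the level `α * B / K`;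
the nonnegative contribution of the initial value is dropped. -/
lemma edge_le (hK : 0 < K) {c d α B : ℝ} (hac : a ≤ c) (hcd : c ≤ d) (hdb : d ≤ b) (i : Fin N)
    (j : Fin (N + 1)) (hα : ∀ s ∈ Ioo c d, α ≤ W s i.succ j) (hB : 0 ≤ B)
    (hj : ∀ s ∈ Ioo c d, B ≤ u j s) :
    α * B / K * (1 - Real.exp (-K * (d - c))) ≤ u i.succ d := by
  have := hσ.lower_bound_of_deriv (f := u i.succ) (K := K) (γ := α * B / K) (ha.trans hac) hcd
    ((hu.continuousOn i).mono (Icc_subset_Icc hac hdb)) (by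
      intro k τ hτ h1 h2
      have hτ' : τ ∈ Icc a b := ⟨hac.trans h1.le, h2.le.trans hdb⟩
      obtain ⟨u', hd, hle⟩ := hu.deriv_ge i k τ hτ (hac.trans_lt h1) (h2.trans_le hdb)
      refine ⟨u', hd, le_trans ?_ hle⟩
      have e1 : α * B ≤ W τ i.succ j * u j τ :=
        (mul_le_mul_of_nonneg_right (hα τ ⟨h1, h2⟩) hB).trans
          (mul_le_mul_of_nonneg_left (hj τ ⟨h1, h2⟩) (hW.nonneg _ _ _))
      have e2 : W τ i.succ j * u j τ ≤ ∑ j, W τ i.succ j * u j τ :=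
        Finset.single_le_sum (f := fun j => W τ i.succ j * u j τ)
          (fun j _ => mul_nonneg (hW.nonneg _ _ _) (hpos j τ hτ')) (Finset.mem_univ j)
      have e3 : (∑ j, W τ i.succ j) * u i.succ τ ≤ K * u i.succ τ :=
        mul_le_mul_of_nonneg_right (hW.sum_le _ _) (hpos _ τ hτ')
      have e4 : K * (α * B / K) = α * B := by field_simp
      rw [mul_sub, e4]
      simp only [mul_sub, Finset.sum_sub_distrib, ← Finset.sum_mul]
      linarith)
  have h2 := mul_nonneg (Real.exp_pos (-K * (d - c))).le
    (hpos i.succ c ⟨hac, hcd.trans hdb⟩)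
  linarith

end IsConsensusSupersolution

/-! ### Spreading of lower bounds along the union graphs -/

/-- If no edge left `R`, the tree paths from the root would never leave `R`. -/
lemma ContainsDirectedSpanningTree.exists_adj {V : Type*} {G : Digraph V} {r : V}
    (h : ContainsDirectedSpanningTree G r) {R : Set V} (hr : r ∈ R) {l : V} (hl : l ∉ R) :
    ∃ j ∈ R, ∃ i ∉ R, G.Adj j i := by
  obtain ⟨T, hT, hroot⟩ := h
  by_contra! hcon
  have key : ∀ x, Relation.TransGen T.Adj r x → x ∈ R := by
    intro x hx
    induction hx with
    | single h => by_contra hx; exact hcon _ hr _ hx (hT h)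
    | tail _ h ih => by_contra hx; exact hcon _ ih _ hx (hT h)
  exact hl (key l (hroot.reachable l (by rintro rfl; exact hl hr)))

lemma Digraph.exists_adj_of_iSup_adj {V ι : Type*} {s : Set ι} {G : ι → Digraph V} {x y : V}
    (h : (⨆ j ∈ s, G j).Adj x y) : ∃ j ∈ s, (G j).Adj x y := by
  simpa [Digraph.iSup_adj] using h

section Contraction

variable {N n₀ : ℕ} {σ : ℝ → Fin n₀} {t : ℕ → ℝ} {G : Fin n₀ → Digraph (Fin (N + 1))}
  {W : ℝ → Matrix (Fin (N + 1)) (Fin (N + 1)) ℝ} {K α τ ε : ℝ} {i : ℕ → ℕ}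

/-- Along a window with jointly connected graphs, one more node acquires a lower bound. -/
lemma exists_reached_succ (hσ : IsSwitchingSignal σ t) (hW : HasBoundedWeights W K) (hK : 0 < K)
    (hα : 0 < α) (hWα : ∀ s j l, (G (σ s)).Adj j l → α ≤ W s l j)
    (hτ : 0 < τ) (hdwell : ∀ k, τ ≤ t (k + 1) - t k) (hi : StrictMono i)
    (hgap : ∀ k, t (i (k + 1)) - t (i k) < ε)
    (hconn : ∀ k, ContainsDirectedSpanningTree (⨆ j ∈ Set.Ico (i k) (i (k + 1)), G (σ (t j))) 0) :
    ∃ κ > 0, κ ≤ 1 ∧ ∀ (k : ℕ) (u : Fin (N + 1) → ℝ → ℝ) (B : ℝ) (R : Finset (Fin (N + 1))),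
      0 ≤ B → IsConsensusSupersolution W t (t (i k)) (t (i (k + 1))) u →
      (∀ l, ∀ s ∈ Icc (t (i k)) (t (i (k + 1))), 0 ≤ u l s) →
      (∀ s ∈ Icc (t (i k)) (t (i (k + 1))), B ≤ u 0 s) → 0 ∈ R →
      (∀ l ∈ R, B ≤ u l (t (i k))) →
      ∃ R' : Finset (Fin (N + 1)), 0 ∈ R' ∧ min (R.card + 1) (N + 1) ≤ R'.card ∧
        ∀ l ∈ R', κ * B ≤ u l (t (i (k + 1))) := by
  have hε : 0 < ε := by
    have := hσ.strictMono (hi (Nat.lt_succ_self 0))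
    linarith [hgap 0]
  set θ := Real.exp (-K * ε) with hθ
  have hθ0 : 0 < θ := Real.exp_pos _
  have hθ1 : θ ≤ 1 := Real.exp_le_one_iff.2 (by nlinarith)
  set ρ := α / K * (1 - Real.exp (-K * τ)) with hρ
  have hρ0 : 0 < ρ := mul_pos (div_pos hα hK)
    (sub_pos.2 (Real.exp_lt_one_iff.2 (by nlinarith)))
  -- The inner `θ` is the loss at the source until its edge has acted, `ρ` the gain across an edge
  -- active for at least `τ`, and the outer `θ` the loss until the window ends. The `min` with 1
  -- makes the product at most `θ`, as the nodes already in `R` require.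
  refine ⟨θ * (θ * min 1 ρ), by positivity, ?_, ?_⟩
  · exact mul_le_one₀ hθ1 (by positivity)
      (mul_le_one₀ hθ1 (by positivity) (min_le_left _ _))
  intro k u B R hB hu hpos h0 h0R hR
  set a := t (i k)
  set b := t (i (k + 1))
  have ha : 0 ≤ a := hσ.nonneg _
  have hab : a < b := hσ.strictMono (hi (Nat.lt_succ_self k))
  have hθle : ∀ c d, a ≤ c → d ≤ b → θ ≤ Real.exp (-K * (d - c)) := fun c d hc hd =>
    Real.exp_le_exp.2 (by nlinarith [hgap k])
  have hκ : θ * (θ * min 1 ρ) ≤ θ := mul_le_of_le_one_right hθ0.le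
    (mul_le_one₀ hθ1 (by positivity) (min_le_left _ _))
  have hκ1 : θ * (θ * min 1 ρ) * B ≤ θ * B := mul_le_mul_of_nonneg_right hκ hB
  have hRd : ∀ l ∈ R, ∀ d, a ≤ d → d ≤ b → θ * B ≤ u l d := by
    intro l hl d had hdb
    induction l using Fin.cases with
    | zero => exact (mul_le_of_le_one_left hB hθ1).trans (h0 d ⟨had, hdb⟩)
    | succ l =>
      exact (mul_le_mul (hθle a d le_rfl hdb) (hR _ hl) hB (Real.exp_pos _).le).trans
        (hu.exp_mul_le hσ hW ha hpos le_rfl had hdb l)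
  by_cases hun : ∃ l, l ∉ R
  · obtain ⟨l, hl⟩ := hun
    obtain ⟨x, hx, y, hy, hxy⟩ := (hconn k).exists_adj (R := (R : Set (Fin (N + 1))))
      (by simpa using h0R) (l := l) (by simpa using hl)
    obtain ⟨m, hm, hadj⟩ := Digraph.exists_adj_of_iSup_adj hxy
    rw [Finset.mem_coe] at hx hy
    refine ⟨insert y R, Finset.mem_insert_of_mem h0R, ?_, ?_⟩
    · rw [Finset.card_insert_of_notMem hy]
      exact min_le_left _ _
    intro z hz
    rcases Finset.mem_insert.1 hz with rfl | hz
    · obtain ⟨z, rfl⟩ := Fin.exists_succ_eq.2 (show z ≠ 0 from fun h => hy (h ▸ h0R))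
      have h1 : a ≤ t m := hσ.strictMono.monotone hm.1
      have h2 : t (m + 1) ≤ b := hσ.strictMono.monotone hm.2
      have h12 : t m < t (m + 1) := hσ.strictMono (Nat.lt_succ_self m)
      have e1 := hu.edge_le hσ hW ha hpos hK h1 h12.le h2 z x (α := α) (B := θ * B)
        (fun s hs => hWα s x z.succ (by rwa [hσ.const m s ⟨hs.1.le, hs.2⟩])) (by positivity)
        (fun s hs => hRd x hx s (h1.trans hs.1.le) (hs.2.le.trans h2))
      have e2 := hu.exp_mul_le hσ hW ha hpos (h1.trans h12.le) h2 le_rfl z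
      have e3 : ρ ≤ α / K * (1 - Real.exp (-K * (t (m + 1) - t m))) := by
        refine mul_le_mul_of_nonneg_left (sub_le_sub_left (Real.exp_le_exp.2 ?_) _)
          (by positivity)
        nlinarith [hdwell m]
      have e4 : θ * min 1 ρ * B ≤ u z.succ (t (m + 1)) := by
        refine le_trans ?_ e1
        calc θ * min 1 ρ * B = min 1 ρ * (θ * B) := by ring
          _ ≤ (α / K * (1 - Real.exp (-K * (t (m + 1) - t m)))) * (θ * B) :=
            mul_le_mul_of_nonneg_right ((min_le_right _ _).trans e3) (by positivity)
          _ = _ := by ring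
      calc θ * (θ * min 1 ρ) * B = θ * (θ * min 1 ρ * B) := by ring
        _ ≤ Real.exp (-K * (b - t (m + 1))) * u z.succ (t (m + 1)) :=
          mul_le_mul (hθle _ _ (h1.trans h12.le) le_rfl) e4 (by positivity) (Real.exp_pos _).le
        _ ≤ _ := e2
    · exact hκ1.trans (hRd z hz b hab.le le_rfl)
  · push Not at hun
    refine ⟨R, h0R, ?_, fun z hz => hκ1.trans (hRd z hz b hab.le le_rfl)⟩
    rw [Finset.eq_univ_iff_forall.2 hun]
    simp

/-- After `N` windows every node has acquired a lower bound. -/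
lemma exists_uniform_lower_bound (hσ : IsSwitchingSignal σ t) (hW : HasBoundedWeights W K)
    (hK : 0 < K)
    (hα : 0 < α) (hWα : ∀ s j l, (G (σ s)).Adj j l → α ≤ W s l j)
    (hτ : 0 < τ) (hdwell : ∀ k, τ ≤ t (k + 1) - t k) (hi : StrictMono i)
    (hgap : ∀ k, t (i (k + 1)) - t (i k) < ε)
    (hconn : ∀ k, ContainsDirectedSpanningTree (⨆ j ∈ Set.Ico (i k) (i (k + 1)), G (σ (t j))) 0) :
    ∃ η > 0, η ≤ 1 ∧ ∀ (k : ℕ) (u : Fin (N + 1) → ℝ → ℝ) (B : ℝ),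
      0 ≤ B → IsConsensusSupersolution W t (t (i k)) (t (i (k + N))) u →
      (∀ l, ∀ s ∈ Icc (t (i k)) (t (i (k + N))), 0 ≤ u l s) →
      (∀ s ∈ Icc (t (i k)) (t (i (k + N))), B ≤ u 0 s) →
      ∀ l, η * B ≤ u l (t (i (k + N))) := by
  obtain ⟨κ, hκ0, hκ1, hκ⟩ := exists_reached_succ hσ hW hK hα hWα hτ hdwell hi hgap hconn
  refine ⟨κ ^ N, pow_pos hκ0 N, pow_le_one₀ hκ0.le hκ1, ?_⟩
  intro k u B hB hu hpos h0
  have hmono : Monotone fun k => t (i k) := (hσ.strictMono.comp hi).monotone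
  -- Starting from `{0}`, each window adds a node at the cost of a factor `κ`.
  have key : ∀ m ≤ N, ∃ R : Finset (Fin (N + 1)), 0 ∈ R ∧ min (m + 1) (N + 1) ≤ R.card ∧
      ∀ l ∈ R, κ ^ m * B ≤ u l (t (i (k + m))) := by
    intro m
    induction m with
    | zero =>
      intro _
      refine ⟨{0}, by simp, by simp, ?_⟩
      simpa using h0 _ (left_mem_Icc.2 (hmono (Nat.le_add_right k N)))
    | succ m ih =>
      intro hm
      obtain ⟨R, h0R, hcard, hR⟩ := ih (by omega)
      have h1 : t (i k) ≤ t (i (k + m)) := hmono (by omega)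
      have h2 : t (i (k + m + 1)) ≤ t (i (k + N)) := hmono (by omega)
      have hsub : ∀ s ∈ Icc (t (i (k + m))) (t (i (k + m + 1))),
          s ∈ Icc (t (i k)) (t (i (k + N))) := fun s hs => ⟨h1.trans hs.1, hs.2.trans h2⟩
      obtain ⟨R', h0R', hcard', hR'⟩ := hκ (k + m) u (κ ^ m * B) R (by positivity)
        (hu.mono h1 h2) (fun l s hs => hpos l s (hsub s hs))
        (fun s hs => (mul_le_of_le_one_left hB (pow_le_one₀ hκ0.le hκ1)).trans
          (h0 s (hsub s hs))) h0R hR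
      refine ⟨R', h0R', by omega, fun l hl => ?_⟩
      have := hR' l hl
      rwa [← mul_assoc, ← pow_succ'] at this
  obtain ⟨R, -, hcard, hR⟩ := key N le_rfl
  have hun : R = Finset.univ := by
    rw [← Finset.card_eq_iff_eq_univ]
    refine le_antisymm (Finset.card_le_univ R) ?_
    simpa using hcard
  exact fun l => hR l (hun ▸ Finset.mem_univ l)

end Contraction

/-! ### Consensus with an exponentially decaying perturbation -/

/-- On `[a, b]`, `x` solves the consensus equation `x i' = ∑ j, W i j * (x j - x i) + d i` with
leader `x 0 = 0` and a perturbation `|d i s| ≤ c * exp (-r * s)`. -/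
structure IsPerturbedConsensus {N : ℕ} (W : ℝ → Matrix (Fin (N + 1)) (Fin (N + 1)) ℝ)
    (t : ℕ → ℝ) (a b c r : ℝ) (x : Fin (N + 1) → ℝ → ℝ) : Prop where
  leader : ∀ s ∈ Icc a b, x 0 s = 0
  continuousOn : ∀ i : Fin N, ContinuousOn (x i.succ) (Icc a b)
  deriv_eq : ∀ (i : Fin N) (k : ℕ), ∀ s ∈ Ioo (t k) (t (k + 1)), a < s → s < b →
    ∃ d, |d| ≤ c * Real.exp (-r * s) ∧
      HasDerivAt (x i.succ) (∑ j, W s i.succ j * (x j s - x i.succ s) + d) s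

namespace IsPerturbedConsensus

variable {N n₀ : ℕ} {σ : ℝ → Fin n₀} {t : ℕ → ℝ}
  {W : ℝ → Matrix (Fin (N + 1)) (Fin (N + 1)) ℝ} {K a b c r M : ℝ} {x : Fin (N + 1) → ℝ → ℝ}

lemma mono (hx : IsPerturbedConsensus W t a b c r x) {a' b' : ℝ} (ha : a ≤ a') (hb : b' ≤ b) :
    IsPerturbedConsensus W t a' b' c r x where
  leader s hs := hx.leader s (Icc_subset_Icc ha hb hs)
  continuousOn i := (hx.continuousOn i).mono (Icc_subset_Icc ha hb)
  deriv_eq i k s hs h1 h2 := hx.deriv_eq i k s hs (ha.trans_lt h1) (h2.trans_le hb)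

lemma neg (hx : IsPerturbedConsensus W t a b c r x) :
    IsPerturbedConsensus W t a b c r (fun i s => -x i s) where
  leader s hs := by simp [hx.leader s hs]
  continuousOn i := (hx.continuousOn i).neg
  deriv_eq i k s hs h1 h2 := by
    obtain ⟨d, hd, h⟩ := hx.deriv_eq i k s hs h1 h2
    refine ⟨-d, by rwa [abs_neg], ?_⟩
    have e : ∑ j, W s i.succ j * (-x j s - -x i.succ s) + -d =
        -(∑ j, W s i.succ j * (x j s - x i.succ s) + d) := by
      rw [neg_add, ← Finset.sum_neg_distrib]
      congr 1
      exact Finset.sum_congr rfl fun j _ => by ring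
    rw [e]
    exact h.neg

/-- The correction is the integral of `c * exp (-r * τ)` from `a` to `s`. Its derivative dominates
the perturbation, and being common to all nodes it cancels in the differences. -/
lemma supersolution (hx : IsPerturbedConsensus W t a b c r x) (hr : 0 < r) (M : ℝ) :
    IsConsensusSupersolution W t a b
      (fun i s => M - x i s + (c / r * Real.exp (-r * a) - c / r * Real.exp (-r * s))) where
  continuousOn i := by
    have := hx.continuousOn i
    fun_prop
  deriv_ge i k s hs h1 h2 := by
    obtain ⟨d, hd, h⟩ := hx.deriv_eq i k s hs h1 h2
    have he : HasDerivAt (fun s => Real.exp (-r * s)) (Real.exp (-r * s) * (-r)) s := by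
      simpa using ((hasDerivAt_id s).const_mul (-r)).exp
    refine ⟨_, (h.const_sub M).add ((he.const_mul (c / r)).const_sub _), ?_⟩
    have e : c / r * (Real.exp (-r * s) * (-r)) = -(c * Real.exp (-r * s)) := by
      field_simp
    rw [e, neg_add, ← Finset.sum_neg_distrib]
    have e2 : ∑ j, W s i.succ j *
        (M - x j s + (c / r * Real.exp (-r * a) - c / r * Real.exp (-r * s)) -
        (M - x i.succ s + (c / r * Real.exp (-r * a) - c / r * Real.exp (-r * s)))) =
        ∑ j, -(W s i.succ j * (x j s - x i.succ s)) :=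
      Finset.sum_congr rfl fun j _ => by ring
    rw [e2]
    linarith [(abs_le.1 hd).2]

lemma supersolution_nonneg (hx : IsPerturbedConsensus W t a b c r x) (hr : 0 < r) (hc : 0 ≤ c)
    (hσ : IsSwitchingSignal σ t) (hW : HasBoundedWeights W K) (ha : 0 ≤ a)
    (hM0 : 0 ≤ M) (hM : ∀ i, x i a ≤ M) :
    ∀ i, ∀ s ∈ Icc a b,
      0 ≤ M - x i s + (c / r * Real.exp (-r * a) - c / r * Real.exp (-r * s)) := by
  refine (hx.supersolution hr M).nonneg hσ hW ha ?_ ?_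
  · intro s hs
    have : c / r * Real.exp (-r * s) ≤ c / r * Real.exp (-r * a) :=
      mul_le_mul_of_nonneg_left (Real.exp_le_exp.2 (by nlinarith [hs.1])) (by positivity)
    rw [hx.leader s hs]
    linarith
  · intro i
    linarith [hM i.succ]

/-- By the minimum principle for `x` and `-x`, the maximum grows by at most the total mass `c / r *
exp (-r * a)` of the perturbation after time `a`. -/
lemma abs_apply_le (hx : IsPerturbedConsensus W t a b c r x) (hr : 0 < r) (hc : 0 ≤ c)
    (hσ : IsSwitchingSignal σ t) (hW : HasBoundedWeights W K) (ha : 0 ≤ a)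
    (hM : ∀ i, |x i a| ≤ M) (i : Fin (N + 1)) {s : ℝ} (hs : s ∈ Icc a b) :
    |x i s| ≤ M + c / r * Real.exp (-r * a) := by
  have hM0 : 0 ≤ M := (abs_nonneg _).trans (hM 0)
  have h1 := hx.supersolution_nonneg hr hc hσ hW ha hM0 (fun i => (le_abs_self _).trans (hM i)) i s
    hs
  have h2 := hx.neg.supersolution_nonneg hr hc hσ hW ha hM0
    (fun i => (neg_le_abs _).trans (hM i)) i s hs
  have : 0 ≤ c / r * Real.exp (-r * s) := by positivity
  exact abs_le.2 ⟨by linarith, by linarith⟩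

end IsPerturbedConsensus

/-- A sequence that contracts up to an exponentially small term decays exponentially. -/
lemma exists_exp_bound_of_contraction {T m : ℕ → ℝ} {ρ c r L : ℝ} (hρ0 : 0 ≤ ρ) (hρ : ρ < 1)
    (hc : 0 ≤ c) (hr : 0 < r) (hL : 0 < L) (hT0 : 0 ≤ T 0) (hT : ∀ n, T n ≤ T (n + 1))
    (hTL : ∀ n, T (n + 1) ≤ T n + L) (hm : ∀ n, m (n + 1) ≤ ρ * m n + c * Real.exp (-r * T n)) :
    ∃ C ≥ 0, ∃ r' > 0, r' ≤ r ∧ ∀ n, m n ≤ C * Real.exp (-r' * T n) := by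
  have hlog : Real.log ((1 + ρ) / 2) < 0 := Real.log_neg (by linarith) (by linarith)
  -- The rate is slow enough that a step of length `L` costs no more than the factor `(1 + ρ) / 2`,
  -- which leaves the margin `(1 - ρ) / 2` to absorb `c`.
  set r' := min r (-Real.log ((1 + ρ) / 2) / L) with hr'
  have hr'0 : 0 < r' := lt_min hr (div_pos (by linarith) hL)
  have hrL : (1 + ρ) / 2 ≤ Real.exp (-r' * L) := by
    rw [← Real.log_le_iff_le_exp (by linarith)]
    have : r' * L ≤ -Real.log ((1 + ρ) / 2) := by
      rw [← le_div_iff₀ hL]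
      exact min_le_right _ _
    linarith
  set C := max (2 * c / (1 - ρ)) (|m 0| * Real.exp (r' * T 0)) with hC
  have hC0 : 0 ≤ C := le_trans (by positivity) (le_max_right _ _)
  refine ⟨C, hC0, r', hr'0, min_le_left _ _, fun n => ?_⟩
  have hTn : ∀ n, 0 ≤ T n := fun n => hT0.trans (monotone_nat_of_le_succ hT (Nat.zero_le n))
  induction n with
  | zero =>
    calc m 0 ≤ |m 0| * Real.exp (r' * T 0) * Real.exp (-r' * T 0) := by
          rw [mul_assoc, ← Real.exp_add]
          simp [le_abs_self]
      _ ≤ _ := mul_le_mul_of_nonneg_right (le_max_right _ _) (Real.exp_pos _).le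
  | succ n ih =>
    have h1 : 2 * c ≤ C * (1 - ρ) := by
      rw [← div_le_iff₀ (by linarith)]
      exact le_max_left _ _
    have h2 : Real.exp (-r * T n) ≤ Real.exp (-r' * T n) :=
      Real.exp_le_exp.2 (by nlinarith [hTn n, min_le_left r (-Real.log ((1 + ρ) / 2) / L)])
    have h3 : Real.exp (-r' * L) * Real.exp (-r' * T n) ≤ Real.exp (-r' * T (n + 1)) := by
      rw [← Real.exp_add]
      exact Real.exp_le_exp.2 (by nlinarith [hTL n])
    calc m (n + 1) ≤ ρ * m n + c * Real.exp (-r * T n) := hm n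
      _ ≤ ρ * (C * Real.exp (-r' * T n)) + c * Real.exp (-r' * T n) :=
        add_le_add (mul_le_mul_of_nonneg_left ih hρ0) (mul_le_mul_of_nonneg_left h2 hc)
      _ = (ρ * C + c) * Real.exp (-r' * T n) := by ring
      _ ≤ (C * ((1 + ρ) / 2)) * Real.exp (-r' * T n) :=
        mul_le_mul_of_nonneg_right (by linarith) (Real.exp_pos _).le
      _ ≤ (C * Real.exp (-r' * L)) * Real.exp (-r' * T n) :=
        mul_le_mul_of_nonneg_right (mul_le_mul_of_nonneg_left hrL hC0) (Real.exp_pos _).le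
      _ = C * (Real.exp (-r' * L) * Real.exp (-r' * T n)) := by ring
      _ ≤ _ := mul_le_mul_of_nonneg_left h3 hC0

section Decay

variable {N n₀ : ℕ} {σ : ℝ → Fin n₀} {t : ℕ → ℝ} {G : Fin n₀ → Digraph (Fin (N + 1))}
  {W : ℝ → Matrix (Fin (N + 1)) (Fin (N + 1)) ℝ} {K α : ℝ}

/-- Exponentially perturbed consensus over jointly connected graphs converges exponentially. -/
lemma IsPerturbedConsensus.exists_exp_bound {c r : ℝ} {x : Fin (N + 1) → ℝ → ℝ}
    (hx : ∀ b, IsPerturbedConsensus W t 0 b c r x) (hc : 0 ≤ c) (hr : 0 < r)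
    (hσ : IsSwitchingSignal σ t) (hG : JointlyConnected G σ t 0)
    (hW : HasBoundedWeights W K) (hK : 0 < K)
    (hα : 0 < α) (hWα : ∀ s j l, (G (σ s)).Adj j l → α ≤ W s l j) :
    ∃ C ≥ 0, ∃ r' > 0, ∀ j s, 0 ≤ s → |x j s| ≤ C * Real.exp (-r' * s) := by
  -- Without followers, sampling every `N` windows would not advance in time.
  rcases Nat.eq_zero_or_pos N with rfl | hN
  · refine ⟨0, le_rfl, 1, one_pos, fun j s hs => ?_⟩
    obtain rfl : j = 0 := Fin.fin_one_eq_zero j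
    rw [(hx s).leader s ⟨hs, le_rfl⟩]
    simp
  obtain ⟨τ, hτ, hdwell⟩ := hσ.dwell
  obtain ⟨i, hi, ⟨ε, hε, hgap⟩, hconn⟩ := hG
  obtain ⟨η, hη0, hη1, hη⟩ :=
    exists_uniform_lower_bound hσ hW hK hα hWα hτ hdwell hi hgap hconn
  set T : ℕ → ℝ := fun n => t (i (n * N)) with hTdef
  have hmono : StrictMono fun k => t (i k) := hσ.strictMono.comp hi
  have hT0 : ∀ n, 0 ≤ T n := fun n => hσ.nonneg _
  have hTsucc : ∀ n, T (n + 1) = t (i (n * N + N)) := fun n => by simp only [T, add_one_mul]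
  have hT : ∀ n, T n ≤ T (n + 1) := fun n => by
    rw [hTsucc]
    exact hmono.monotone (Nat.le_add_right _ _)
  have hTL : ∀ n, T (n + 1) ≤ T n + N * ε := by
    intro n
    rw [hTsucc]
    have : ∀ m k : ℕ, t (i (k + m)) ≤ t (i k) + m * ε := by
      intro m k
      induction m with
      | zero => simp
      | succ m ih => push_cast; rw [← add_assoc]; linarith [hgap (k + m)]
    exact this N (n * N)
  have hL : 0 < (N : ℝ) * ε := by positivity
  set m : ℕ → ℝ := fun n => ⨆ j, |x j (T n)| with hmdef
  have hxm : ∀ n j, |x j (T n)| ≤ m n := fun n j =>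
    le_ciSup (f := fun j => |x j (T n)|) (Set.finite_range _).bddAbove j
  have hm0 : ∀ n, 0 ≤ m n := fun n => (abs_nonneg _).trans (hxm n 0)
  have hstep : ∀ n, m (n + 1) ≤ (1 - η) * m n + c / r * Real.exp (-r * T n) := by
    intro n
    refine ciSup_le fun j => ?_
    -- One-sided contraction: the corrected gap `m n - y j + ⋯` is at least `η * m n` at the next
    -- sample.
    have hside : ∀ y : Fin (N + 1) → ℝ → ℝ, (∀ b, IsPerturbedConsensus W t 0 b c r y) →
        (∀ j, y j (T n) ≤ m n) →
        y j (T (n + 1)) ≤ (1 - η) * m n + c / r * Real.exp (-r * T n) := by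
      intro y hy hym
      have hy' := (hy (T (n + 1))).mono (hT0 n) le_rfl
      have hpos := hy'.supersolution_nonneg hr hc hσ hW (hT0 n) (hm0 n) hym
      have hsup := hy'.supersolution hr (m n)
      rw [hTsucc] at hy' hpos hsup
      have := hη (n * N) _ (m n) (hm0 n) hsup hpos (by
        intro s hs
        have : c / r * Real.exp (-r * s) ≤ c / r * Real.exp (-r * T n) :=
          mul_le_mul_of_nonneg_left (Real.exp_le_exp.2 (by nlinarith [hs.1])) (by positivity)
        rw [hy'.leader s hs]
        linarith) j
      rw [hTsucc]
      have h2 : 0 ≤ c / r * Real.exp (-r * t (i (n * N + N))) := by positivity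
      linarith
    have h1 := hside x hx fun j => (le_abs_self _).trans (hxm n j)
    have h2 := hside _ (fun b => (hx b).neg) fun j => (neg_le_abs _).trans (hxm n j)
    exact abs_le.2 ⟨by linarith, h1⟩
  obtain ⟨C, hC0, r', hr'0, hr'r, hC⟩ := exists_exp_bound_of_contraction (m := m)
    (by linarith) (by linarith : 1 - η < 1) (by positivity : 0 ≤ c / r) hr hL (hT0 0) hT hTL hstep
  obtain ⟨M, hM⟩ : ∃ M, ∀ j, |x j 0| ≤ M :=
    ⟨⨆ j, |x j 0|, le_ciSup (f := fun j => |x j 0|) (Set.finite_range _).bddAbove⟩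
  have hM0 : 0 ≤ M := (abs_nonneg _).trans (hM 0)
  -- The first summand interpolates between samples, at most `N * ε` apart; the second covers times
  -- before `T 0`, which may be positive.
  set C' := (C + c / r) * Real.exp (r' * (N * ε)) + (M + c / r) * Real.exp (r' * T 0) with hC'
  have hcr : 0 ≤ c / r := by positivity
  refine ⟨C', by positivity, r', hr'0, fun j s hs => ?_⟩
  have hTtop : ∃ n, s < T n := by
    obtain ⟨n, hn⟩ := hσ.exists_le (s + 1)
    refine ⟨n, lt_of_lt_of_le (by linarith) (hn.trans (hσ.strictMono.monotone ?_))⟩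
    exact (Nat.le_mul_of_pos_right n hN).trans (hi.id_le _)
  classical
  rcases Nat.eq_zero_or_pos (Nat.find hTtop) with h0 | hpos
  · have hsT : s < T 0 := by simpa [h0] using Nat.find_spec hTtop
    have h1 := (hx s).abs_apply_le hr hc hσ hW le_rfl hM j ⟨hs, le_rfl⟩
    have h2 : 1 ≤ Real.exp (r' * T 0) * Real.exp (-r' * s) := by
      rw [← Real.exp_add]
      exact Real.one_le_exp (by nlinarith)
    have h3 : 0 ≤ (C + c / r) * Real.exp (r' * (N * ε)) * Real.exp (-r' * s) := by positivity
    rw [mul_zero, Real.exp_zero, mul_one] at h1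
    have h4 := mul_le_mul_of_nonneg_left h2 (add_nonneg hM0 hcr)
    rw [hC', add_mul]
    linarith
  · obtain ⟨n, hn⟩ := Nat.exists_eq_succ_of_ne_zero hpos.ne'
    have h1 : s < T (n + 1) := by
      have := Nat.find_spec hTtop
      rwa [hn] at this
    have h2 : T n ≤ s := by
      have := Nat.find_min hTtop (m := n) (by omega)
      exact not_lt.1 this
    have h3 := ((hx s).mono (hT0 n) le_rfl).abs_apply_le hr hc hσ hW (hT0 n) (hxm n) j ⟨h2, le_rfl⟩
    have h4 : Real.exp (-r * T n) ≤ Real.exp (-r' * T n) :=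
      Real.exp_le_exp.2 (by nlinarith [hT0 n])
    have h5 : Real.exp (-r' * T n) ≤ Real.exp (r' * (N * ε)) * Real.exp (-r' * s) := by
      rw [← Real.exp_add]
      exact Real.exp_le_exp.2 (by nlinarith [hTL n])
    have h6 : 0 ≤ (M + c / r) * Real.exp (r' * T 0) * Real.exp (-r' * s) := by positivity
    have h7 := mul_le_mul_of_nonneg_left h4 hcr
    have h8 := mul_le_mul_of_nonneg_left h5 (add_nonneg hC0 hcr)
    rw [hC', add_mul]
    linarith [hC n]

/-- Exponential consensus for a finite family whose perturbation is dominated by an exponentially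
decaying multiple of the size of the whole family. -/
lemma exists_exp_bound_family {ι : Type*} [Finite ι] {x : ι → Fin (N + 1) → ℝ → ℝ} {c r : ℝ}
    (hc : 0 ≤ c) (hr : 0 < r) (hσ : IsSwitchingSignal σ t) (hG : JointlyConnected G σ t 0)
    (hW : HasBoundedWeights W K) (hK : 0 < K)
    (hα : 0 < α) (hWα : ∀ s j l, (G (σ s)).Adj j l → α ≤ W s l j)
    (hx0 : ∀ l s, 0 ≤ s → x l 0 s = 0)
    (hcont : ∀ l (j : Fin N), ContinuousOn (x l j.succ) (Ici 0))
    (hderiv : ∀ l (j : Fin N) k, ∀ s ∈ Ioo (t k) (t (k + 1)),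
      ∃ d, (∀ P, (∀ l j, |x l j s| ≤ P) → |d| ≤ c * Real.exp (-r * s) * (P + 1)) ∧
        HasDerivAt (x l j.succ) (∑ j', W s j.succ j' * (x l j' s - x l j.succ s) + d) s) :
    ∃ C ≥ 0, ∃ r' > 0, ∀ l j s, 0 ≤ s → |x l j s| ≤ C * Real.exp (-r' * s) := by
  cases nonempty_fintype ι
  rcases isEmpty_or_nonempty ι with hι | hι
  · exact ⟨0, le_rfl, 1, one_pos, fun l => hι.elim l⟩
  have hcont' : ∀ l j, ContinuousOn (x l j) (Ici 0) := by
    intro l j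
    induction j using Fin.cases with
    | zero => exact continuousOn_const.congr (hx0 l)
    | succ j => exact hcont l j
  have hbdd : ∀ a b, 0 ≤ a → a ≤ b → ∃ P, 0 ≤ P ∧ (∀ l j, ∀ s ∈ Icc a b, |x l j s| ≤ P) ∧
      ∃ l j, ∃ s ∈ Icc a b, |x l j s| = P := by
    intro a b ha hab
    choose m hm hmax using fun p : ι × Fin (N + 1) =>
      isCompact_Icc.exists_isMaxOn (nonempty_Icc.2 hab)
        ((hcont' p.1 p.2).abs.mono (Icc_subset_Ici_iff hab |>.2 ha))
    obtain ⟨p, hp⟩ := Finite.exists_max fun p : ι × Fin (N + 1) => |x p.1 p.2 (m p)|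
    exact ⟨_, abs_nonneg _, fun l j s hs => (hmax (l, j) hs).trans (hp (l, j)), p.1, p.2, m p,
      hm p, rfl⟩
  have hpert : ∀ a b P, 0 ≤ a → (∀ l j, ∀ s ∈ Icc a b, |x l j s| ≤ P) → ∀ l,
      IsPerturbedConsensus W t a b (c * (P + 1)) r (x l) := by
    intro a b P ha hP l
    refine ⟨fun s hs => hx0 l s (ha.trans hs.1),
      fun j => (hcont l j).mono fun s hs => ha.trans hs.1, ?_⟩
    intro j k s hs h1 h2
    obtain ⟨d, hd, h⟩ := hderiv l j k s hs
    refine ⟨d, ?_, h⟩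
    have := hd P fun l j => hP l j s ⟨h1.le, h2.le⟩
    linarith
  -- After `a` the perturbation has mass at most `(P + 1) / 2`, where `P` is the maximum on `[a,
  -- s]`. Hence `P ≤ M + (P + 1) / 2`, that is, `P ≤ 2 * M + 1`, uniformly in `s`.
  obtain ⟨a, ha0, ha⟩ : ∃ a, 0 ≤ a ∧ c / r * Real.exp (-r * a) ≤ 1 / 2 := by
    have h1 : Tendsto (fun a => c / r * Real.exp (-r * a)) atTop (nhds (c / r * 0)) := by
      refine Tendsto.const_mul _ (Real.tendsto_exp_atBot.comp ?_)
      exact tendsto_id.const_mul_atTop_of_neg (by linarith)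
    rw [mul_zero] at h1
    obtain ⟨a, h2, h3⟩ := ((h1.eventually_le_const (by norm_num : (0 : ℝ) < 1 / 2)).and
      (eventually_ge_atTop 0)).exists
    exact ⟨a, h3, h2⟩
  obtain ⟨M, hM0, hM, -⟩ := hbdd 0 a le_rfl ha0
  have hglob : ∀ l j s, 0 ≤ s → |x l j s| ≤ 2 * M + 1 := by
    intro l j s hs
    rcases le_total s a with hsa | has
    · linarith [hM l j s ⟨hs, hsa⟩]
    obtain ⟨P, hP0, hP, l', j', s', hs', hPeq⟩ := hbdd a s ha0 has
    have h1 := (hpert a s P ha0 hP l').abs_apply_le hr (by positivity) hσ hW ha0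
      (fun i => hM l' i a ⟨ha0, le_rfl⟩) j' hs'
    rw [hPeq] at h1
    have h2 : c * (P + 1) / r * Real.exp (-r * a) =
        (c / r * Real.exp (-r * a)) * (P + 1) := by ring
    rw [h2] at h1
    have h3 := mul_le_mul_of_nonneg_right ha (by linarith : 0 ≤ P + 1)
    linarith [hP l j s ⟨has, le_rfl⟩]
  -- With the global bound inserted, the perturbation coefficient is constant and each member is
  -- treated separately.
  choose C hC0 r' hr' hle using fun l =>
    IsPerturbedConsensus.exists_exp_bound (c := c * (2 * M + 1 + 1)) (r := r) (x := x l)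
      (fun b => hpert 0 b _ le_rfl (fun l j s hs => hglob l j s hs.1) l) (by positivity) hr
      hσ hG hW hK hα hWα
  obtain ⟨l₀, hl₀⟩ := Finite.exists_min r'
  refine ⟨∑ l, C l, Finset.sum_nonneg fun l _ => hC0 l, r' l₀, hr' l₀, fun l j s hs => ?_⟩
  refine (hle l j s hs).trans (mul_le_mul ?_ (Real.exp_le_exp.2 ?_) (Real.exp_pos _).le
    (Finset.sum_nonneg fun l _ => hC0 l))
  · exact Finset.single_le_sum (f := C) (fun l _ => hC0 l) (Finset.mem_univ l)
  · nlinarith [hl₀ l]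

end Decay

/-! ### Eigencoordinates, norms and weight bounds -/

/-- A real matrix with distinct imaginary eigenvalues is diagonalized over `ℂ` by the coordinates
`φ l` given by its left eigenvectors. -/
lemma HasDistinctImaginaryEigenvalues.exists_coordinates {q : ℕ} {S : Matrix (Fin q) (Fin q) ℝ}
    (hS : HasDistinctImaginaryEigenvalues S) :
    ∃ (z : Fin q → ℂ) (φ : Fin q → (Fin q → ℝ) →L[ℝ] ℂ) (C : ℝ), 0 ≤ C ∧
      (∀ l, (z l).re = 0) ∧ (∀ l y, φ l (S *ᵥ y) = z l * φ l y) ∧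
      (∀ l y, ‖φ l y‖ ≤ C * ‖y‖) ∧
      ∀ y p, 0 ≤ p → (∀ l, ‖φ l y‖ ≤ p) → ‖y‖ ≤ C * p := by
  classical
  set M := S.map (algebraMap ℝ ℂ) with hM
  have hcard : M.charpoly.roots.toFinset.card = q := by
    rw [Multiset.toFinset_card_of_nodup hS.1,
      (IsAlgClosed.splits M.charpoly).natDegree_eq_card_roots.symm,
      Matrix.charpoly_natDegree_eq_dim, Fintype.card_fin]
  let e := (Finset.equivFinOfCardEq hcard).symm
  set z : Fin q → ℂ := fun l => (e l : ℂ) with hz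
  have hzinj : Function.Injective z := Subtype.val_injective.comp e.injective
  have hzroot : ∀ l, z l ∈ M.charpoly.roots := fun l => Multiset.mem_toFinset.1 (e l).2
  have hex : ∀ l, ∃ ξ : Fin q → ℂ, ξ ≠ 0 ∧ ξ ᵥ* M = z l • ξ := by
    intro l
    have h1 : M.charpoly.eval (z l) = 0 := (Polynomial.mem_roots'.1 (hzroot l)).2
    rw [Matrix.eval_charpoly] at h1
    obtain ⟨ξ, hξ0, hξ⟩ := Matrix.exists_vecMul_eq_zero_iff.2 h1
    refine ⟨ξ, hξ0, ?_⟩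
    rw [Matrix.vecMul_sub, sub_eq_zero] at hξ
    rw [← hξ]
    ext a
    simp [Matrix.vecMul, dotProduct, Matrix.diagonal_apply, mul_comm]
  choose ξ hξ0 hξ using hex
  -- Left eigenvectors are eigenvectors of the transpose, here for distinct eigenvalues.
  have hli : LinearIndependent ℂ ξ := by
    refine Module.End.eigenvectors_linearIndependent' (Matrix.toLin' Mᵀ) z hzinj ξ fun l => ?_
    refine Module.End.hasEigenvector_iff.2 ⟨Module.End.mem_eigenspace_iff.2 ?_, hξ0 l⟩
    rw [Matrix.toLin'_apply, Matrix.mulVec_transpose, hξ]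
  set P : Matrix (Fin q) (Fin q) ℂ := Matrix.of ξ with hP
  have hunit : IsUnit P := Matrix.linearIndependent_rows_iff_isUnit.1 hli
  have hQP : P⁻¹ * P = 1 := Matrix.nonsing_inv_mul P ((Matrix.isUnit_iff_isUnit_det P).1 hunit)
  set φ : Fin q → (Fin q → ℝ) →L[ℝ] ℂ := fun l =>
    ∑ b, (ContinuousLinearMap.proj (R := ℝ) (φ := fun _ : Fin q => ℝ) b).smulRight (P l b) with hφ
  have hφa : ∀ l y, φ l y = ∑ b, P l b * (y b : ℂ) := by
    intro l y
    simp [hφ, mul_comm]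
  have hQ0 : 0 ≤ ∑ a, ∑ l, ‖P⁻¹ a l‖ :=
    Finset.sum_nonneg fun _ _ => Finset.sum_nonneg fun _ _ => norm_nonneg _
  have hφ0 : 0 ≤ ∑ l, ‖φ l‖ := Finset.sum_nonneg fun _ _ => norm_nonneg _
  refine ⟨z, φ, ∑ l, ‖φ l‖ + ∑ a, ∑ l, ‖P⁻¹ a l‖, by positivity, fun l => hS.2 _ (hzroot l),
    ?_, ?_, ?_⟩
  · intro l y
    have h1 : ∀ c, ∑ b, P l b * (S b c : ℂ) = z l * P l c := fun c => by
      simpa [Matrix.vecMul, dotProduct, hM, hP] using congrFun (hξ l) c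
    rw [hφa, hφa]
    simp only [Matrix.mulVec, dotProduct, Complex.ofReal_sum, Complex.ofReal_mul, Finset.mul_sum]
    rw [Finset.sum_comm]
    refine Finset.sum_congr rfl fun c _ => ?_
    rw [← mul_assoc, ← h1, Finset.sum_mul]
    exact Finset.sum_congr rfl fun b _ => by ring
  · intro l y
    refine ((φ l).le_opNorm y).trans (mul_le_mul_of_nonneg_right ?_ (norm_nonneg _))
    have := Finset.single_le_sum (f := fun l => ‖φ l‖) (fun l _ => norm_nonneg _)
      (Finset.mem_univ l)
    linarith
  · intro y p hp hy
    refine (pi_norm_le_iff_of_nonneg (by positivity)).2 fun a => ?_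
    -- The coordinates are `P y`, so `P⁻¹` recovers `y`.
    have h1 : ∑ l, P⁻¹ a l * φ l y = (y a : ℂ) := by
      simp only [hφa, Finset.mul_sum, ← mul_assoc]
      rw [Finset.sum_comm]
      simp only [← Finset.sum_mul, ← Matrix.mul_apply, hQP]
      simp [Matrix.one_apply]
    calc ‖y a‖ = ‖(y a : ℂ)‖ := (Complex.norm_real _).symm
      _ ≤ ∑ l, ‖P⁻¹ a l * φ l y‖ := h1 ▸ norm_sum_le _ _
      _ ≤ ∑ l, ‖P⁻¹ a l‖ * p := Finset.sum_le_sum fun l _ => by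
        rw [norm_mul]
        exact mul_le_mul_of_nonneg_left (hy l) (norm_nonneg _)
      _ = (∑ l, ‖P⁻¹ a l‖) * p := (Finset.sum_mul ..).symm
      _ ≤ _ := by
        refine mul_le_mul_of_nonneg_right ?_ hp
        have := Finset.single_le_sum (f := fun a => ∑ l, ‖P⁻¹ a l‖)
          (fun a _ => Finset.sum_nonneg fun l _ => norm_nonneg _) (Finset.mem_univ a)
        linarith

/-- A linear map from a finite-dimensional space is bounded, so entrywise decay passes to both the
operator norm and the Euclidean norm. -/
lemma exponentiallyTendsToZero_of_coordinates {ι E : Type*} [Fintype ι] [NormedAddCommGroup E]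
    [NormedSpace ℝ E] (L : (ι → ℝ) →ₗ[ℝ] E) {f : ℝ → ι → ℝ} {C r : ℝ} (hC : 0 ≤ C) (hr : 0 < r)
    (h : ∀ i s, 0 ≤ s → |f s i| ≤ C * Real.exp (-r * s)) :
    ExponentiallyTendsToZero fun s => L (f s) := by
  set L' := LinearMap.toContinuousLinearMap L
  refine ⟨‖L'‖ * C + 1, by positivity, r, hr, fun s hs => ?_⟩
  have h1 : ‖f s‖ ≤ C * Real.exp (-r * s) :=
    (pi_norm_le_iff_of_nonneg (by positivity)).2 fun i => h i s hs
  calc ‖L (f s)‖ = ‖L' (f s)‖ := rfl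
    _ ≤ ‖L'‖ * ‖f s‖ := L'.le_opNorm _
    _ ≤ ‖L'‖ * (C * Real.exp (-r * s)) := mul_le_mul_of_nonneg_left h1 (norm_nonneg _)
    _ ≤ _ := by
      rw [add_mul, mul_assoc]
      linarith [Real.exp_pos (-r * s)]

lemma exists_weight_bounds {N n₀ : ℕ} {G : Fin n₀ → Digraph (Fin (N + 1))}
    {A : Fin n₀ → Matrix (Fin (N + 1)) (Fin (N + 1)) ℝ} (hA : ∀ p, IsWeightedAdjacency (G p) (A p))
    (σ : ℝ → Fin n₀) {μ : ℝ} (hμ : 0 < μ) :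
    ∃ K > 0, ∃ α > 0, HasBoundedWeights (fun s => μ • A (σ s)) K ∧
      ∀ s j l, (G (σ s)).Adj j l → α ≤ (μ • A (σ s)) l j := by
  classical
  have hrow : ∀ p i, 0 ≤ ∑ j, A p i j := fun p i => Finset.sum_nonneg fun j _ => (hA p).nonneg i j
  have hmat : ∀ p, 0 ≤ ∑ i, ∑ j, A p i j := fun p => Finset.sum_nonneg fun i _ => hrow p i
  have htot : 0 ≤ ∑ p, ∑ i, ∑ j, A p i j := Finset.sum_nonneg fun p _ => hmat p
  have : Nonempty (Fin n₀) := ⟨σ 0⟩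
  -- The smallest positive weight; zero weights are replaced by the default 1 so that the minimum
  -- stays positive.
  obtain ⟨m, hm⟩ := Finite.exists_min fun x : Fin n₀ × Fin (N + 1) × Fin (N + 1) =>
    if 0 < A x.1 x.2.1 x.2.2 then A x.1 x.2.1 x.2.2 else 1
  refine ⟨μ * ∑ p, ∑ i, ∑ j, A p i j + 1, by positivity,
    μ * (if 0 < A m.1 m.2.1 m.2.2 then A m.1 m.2.1 m.2.2 else 1), ?_, ⟨?_, ?_⟩, ?_⟩
  · refine mul_pos hμ ?_
    split_ifs with h
    exacts [h, one_pos]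
  · exact fun s i j => mul_nonneg hμ.le ((hA _).nonneg i j)
  · intro s i
    simp only [Matrix.smul_apply, smul_eq_mul, ← Finset.mul_sum]
    have h1 : ∑ j, A (σ s) i j ≤ ∑ i, ∑ j, A (σ s) i j :=
      Finset.single_le_sum (f := fun i => ∑ j, A (σ s) i j) (fun i _ => hrow _ i)
        (Finset.mem_univ i)
    have h2 : ∑ i, ∑ j, A (σ s) i j ≤ ∑ p, ∑ i, ∑ j, A p i j :=
      Finset.single_le_sum (f := fun p => ∑ i, ∑ j, A p i j) (fun p _ => hmat p)
        (Finset.mem_univ (σ s))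
    have := mul_le_mul_of_nonneg_left (h1.trans h2) hμ.le
    linarith
  · intro s j l hjl
    refine mul_le_mul_of_nonneg_left ?_ hμ.le
    simpa [((hA _).pos_iff l j).2 hjl] using hm (σ s, l, j)

/-- Each `exp (-z l * s) * φ l (v s)` is constant and the exponential has modulus 1, so the
eigencoordinates of `v` keep their modulus. -/
lemma IsLeaderTrajectory.exists_norm_le {q : ℕ} {S : Matrix (Fin q) (Fin q) ℝ}
    (hS : HasDistinctImaginaryEigenvalues S) {v : ℝ → Fin q → ℝ} (hv : IsLeaderTrajectory S v) :
    ∃ V, 0 ≤ V ∧ ∀ s, 0 ≤ s → ‖v s‖ ≤ V := by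
  obtain ⟨z, φ, C, hC0, hz, hφS, hφle, hle⟩ := hS.exists_coordinates
  refine ⟨C * (C * ‖v 0‖), by positivity, fun s hs => hle _ _ (by positivity) fun l => ?_⟩
  have hexp : ∀ s : ℝ, ‖Complex.exp (-z l * s)‖ = 1 := fun s => by
    simp [Complex.norm_exp, hz l]
  have hd : ∀ τ, 0 ≤ τ → HasDerivWithinAt (fun τ : ℝ => Complex.exp (-z l * τ) * φ l (v τ)) 0
      (Ici 0) τ := by
    intro τ hτ
    have h1 : HasDerivAt (fun τ : ℝ => Complex.exp (-z l * τ))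
        (Complex.exp (-z l * τ) * (-z l)) τ := by
      simpa using ((Complex.ofRealCLM.hasDerivAt (x := τ)).const_mul (-z l)).cexp
    have h2 : HasDerivWithinAt (fun τ => φ l (v τ)) (φ l (S *ᵥ v τ)) (Ici 0) τ :=
      (φ l).hasFDerivAt.comp_hasDerivWithinAt τ (hv τ hτ)
    have h3 := h1.hasDerivWithinAt.mul h2
    rw [hφS] at h3
    exact h3.congr_deriv (by ring)
  have hconst := constant_of_has_deriv_right_zero (a := 0) (b := s)
    (fun τ hτ => ((hd τ hτ.1).continuousWithinAt).mono Icc_subset_Ici_self)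
    (fun τ hτ => (hd τ hτ.1).mono (Ici_subset_Ici.2 hτ.1)) s ⟨hs, le_rfl⟩
  have := congrArg norm hconst
  rw [norm_mul, norm_mul, hexp, hexp, one_mul, one_mul] at this
  rw [this]
  exact hφle l _

/-! ### The two observer errors -/

namespace IsAdaptiveObserver

variable {N q n₀ : ℕ} {S : Matrix (Fin q) (Fin q) ℝ} {v : ℝ → Fin q → ℝ}
  {G : Fin n₀ → Digraph (Fin (N + 1))}
  {A : Fin n₀ → Matrix (Fin (N + 1)) (Fin (N + 1)) ℝ} {σ : ℝ → Fin n₀} {t : ℕ → ℝ} {μ₁ μ₂ : ℝ}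
  {Shat : Fin (N + 1) → ℝ → Matrix (Fin q) (Fin q) ℝ} {vhat : Fin (N + 1) → ℝ → Fin q → ℝ}

/-- Entrywise this is unperturbed consensus, so `c = 0` and the rate `r = 1` is arbitrary. -/
lemma exists_exp_bound_errorS (hobs : IsAdaptiveObserver S v A σ t μ₁ μ₂ Shat vhat)
    (hA : ∀ p, IsWeightedAdjacency (G p) (A p)) (hσ : IsSwitchingSignal σ t)
    (hG : JointlyConnected G σ t 0) (hμ₁ : 0 < μ₁) :
    ∃ C ≥ 0, ∃ r > 0, ∀ j a b s, 0 ≤ s → |(Shat j s - S) a b| ≤ C * Real.exp (-r * s) := by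
  obtain ⟨K, hK, α, hα, hW, hWα⟩ := exists_weight_bounds hA σ hμ₁
  obtain ⟨C, hC, r, hr, h⟩ := exists_exp_bound_family
    (x := fun (p : Fin q × Fin q) j s => (Shat j s - S) p.1 p.2) (c := 0) (r := 1) le_rfl one_pos
    hσ hG hW hK hα hWα (fun p s hs => by simp [hobs.leader_S s hs])
    (fun p j => by
      have h1 := continuousOn_pi.1 (continuousOn_pi.1 (hobs.continuousOn_S j) p.1) p.2
      exact h1.sub continuousOn_const)
    (fun p j k s hs => by
      refine ⟨0, fun P _ => by simp, ?_⟩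
      let ev : Matrix (Fin q) (Fin q) ℝ →L[ℝ] ℝ :=
        { toFun := fun M => M p.1 p.2
          map_add' := fun _ _ => rfl
          map_smul' := fun _ _ => rfl
          cont := (continuous_apply p.2).comp (continuous_apply p.1) }
      have h1 : HasDerivAt (fun s => Shat j.succ s p.1 p.2) _ s :=
        ev.hasFDerivAt.comp_hasDerivAt s (hobs.hasDerivAt_S j k s hs)
      refine (h1.sub_const (S p.1 p.2)).congr_deriv ?_
      change (μ₁ • ∑ j', A (σ s) j.succ j' • (Shat j' s - Shat j.succ s)) p.1 p.2 = _
      simp [Matrix.sum_apply, Finset.mul_sum, mul_assoc])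
  exact ⟨C, hC, r, hr, fun j a b s hs => h (a, b) j s hs⟩

lemma exists_exp_bound_errorV (hobs : IsAdaptiveObserver S v A σ t μ₁ μ₂ Shat vhat)
    (hS : HasDistinctImaginaryEigenvalues S) (hv : IsLeaderTrajectory S v)
    (hA : ∀ p, IsWeightedAdjacency (G p) (A p)) (hσ : IsSwitchingSignal σ t)
    (hG : JointlyConnected G σ t 0) (hμ₁ : 0 < μ₁) (hμ₂ : 0 < μ₂) :
    ∃ C ≥ 0, ∃ r > 0, ∀ j s, 0 ≤ s → ‖vhat j s - v s‖ ≤ C * Real.exp (-r * s) := by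
  obtain ⟨K, hK, α, hα, hW, hWα⟩ := exists_weight_bounds hA σ hμ₂
  obtain ⟨z, φ, C, hC0, hz, hφS, hφle, hle⟩ := hS.exists_coordinates
  obtain ⟨V, hV0, hV⟩ := hv.exists_norm_le hS
  obtain ⟨C₁, hC₁, r, hr, hSb⟩ := hobs.exists_exp_bound_errorS hA hσ hG hμ₁
  have hexp : ∀ l, ∀ s : ℝ, ‖Complex.exp (-z l * s)‖ = 1 := fun l s => by
    simp [Complex.norm_exp, hz l]
  set w : Fin q → Fin (N + 1) → ℝ → ℂ := fun l j s =>
    Complex.exp (-z l * s) * φ l (vhat j s - v s) with hw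
  have hwφ : ∀ l j s, ‖w l j s‖ = ‖φ l (vhat j s - v s)‖ := fun l j s => by
    simp only [hw]
    rw [norm_mul, hexp, one_mul]
  -- The consensus estimates are for real functions; the weights are real, so real and imaginary
  -- parts satisfy the same equation.
  set part : Bool → ℂ →L[ℝ] ℝ := fun c => if c then Complex.reCLM else Complex.imCLM with hpart
  have hpart_le : ∀ c x, |part c x| ≤ ‖x‖ := by
    intro c x
    cases c
    · exact Complex.abs_im_le_norm x
    · exact Complex.abs_re_le_norm x
  have hle_part : ∀ x P, (∀ c, |part c x| ≤ P) → ‖x‖ ≤ 2 * P := by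
    intro x P h
    have h1 : |x.re| ≤ P := h true
    have h2 : |x.im| ≤ P := h false
    linarith [Complex.norm_le_abs_re_add_abs_im x]
  have hvle : ∀ j s P, (∀ p : Fin q × Bool, |part p.2 (w p.1 j s)| ≤ P) → 0 ≤ P →
      ‖vhat j s - v s‖ ≤ C * (2 * P) := by
    intro j s P h hP
    refine hle _ _ (by positivity) fun l => ?_
    rw [← hwφ]
    exact hle_part _ _ fun c => h (l, c)
  have hvcont : ContinuousOn v (Ici 0) := fun s hs => (hv s hs).continuousWithinAt
  have hmul : ∀ j s, 0 ≤ s → ‖(Shat j s - S) *ᵥ vhat j s‖ ≤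
      q * (C₁ * Real.exp (-r * s)) * ‖vhat j s‖ := by
    intro j s hs
    refine (pi_norm_le_iff_of_nonneg (by positivity)).2 fun a => ?_
    calc ‖((Shat j s - S) *ᵥ vhat j s) a‖
        ≤ ∑ b, ‖(Shat j s - S) a b * vhat j s b‖ := by
          change ‖∑ b, (Shat j s - S) a b * vhat j s b‖ ≤ _
          exact norm_sum_le _ _
      _ ≤ ∑ _b : Fin q, C₁ * Real.exp (-r * s) * ‖vhat j s‖ := Finset.sum_le_sum fun b _ => by
        rw [norm_mul]
        exact mul_le_mul (hSb j a b s hs) (norm_le_pi_norm _ b) (norm_nonneg _) (by positivity)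
      _ = _ := by
        rw [Finset.sum_const, Finset.card_univ, Fintype.card_fin, nsmul_eq_mul]
        ring
  obtain ⟨C₂, hC₂, r₂, hr₂, h⟩ := exists_exp_bound_family
    (x := fun (p : Fin q × Bool) j s => part p.2 (w p.1 j s))
    -- `C * q * C₁` bounds the effect of `Shat j - S` in eigencoordinates, and `‖vhat j‖ ≤ 2 * C * P
    -- + V ≤ (2 * C + V) * (P + 1)`.
    (c := C * (q * C₁) * (2 * C + V)) (r := r) (by positivity) hr
    hσ hG hW hK hα hWα (fun p s hs => by simp [hw, hobs.leader_v s hs])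
    (fun p j => by
      have h1 := hobs.continuousOn_v j
      have h2 : Continuous fun s : ℝ => Complex.exp (-z p.1 * s) := by fun_prop
      exact (part p.2).continuous.comp_continuousOn
        (h2.continuousOn.mul ((φ p.1).continuous.comp_continuousOn (h1.sub hvcont))))
    (fun p j k s hs => by
      obtain ⟨l, c⟩ := p
      have hs0 : 0 < s := (hσ.nonneg k).trans_lt hs.1
      refine ⟨part c (Complex.exp (-z l * s) *
        φ l ((Shat j.succ s - S) *ᵥ vhat j.succ s)), fun P hP => ?_, ?_⟩
      · have hP0 : 0 ≤ P := (abs_nonneg _).trans (hP (l, c) 0)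
        refine (hpart_le _ _).trans ?_
        rw [norm_mul, hexp, one_mul]
        have h1 := hvle j.succ s P (fun p => hP p j.succ) hP0
        have h2 : ‖vhat j.succ s‖ ≤ (2 * C + V) * (P + 1) := by
          have h3 : ‖vhat j.succ s‖ ≤ ‖vhat j.succ s - v s‖ + ‖v s‖ := by
            simpa using norm_add_le (vhat j.succ s - v s) (v s)
          have h4 := hV s hs0.le
          nlinarith [mul_nonneg hV0 hP0]
        calc ‖φ l ((Shat j.succ s - S) *ᵥ vhat j.succ s)‖
            ≤ C * ‖(Shat j.succ s - S) *ᵥ vhat j.succ s‖ := hφle _ _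
          _ ≤ C * (q * (C₁ * Real.exp (-r * s)) * ‖vhat j.succ s‖) :=
            mul_le_mul_of_nonneg_left (hmul _ _ hs0.le) hC0
          _ ≤ C * (q * (C₁ * Real.exp (-r * s)) * ((2 * C + V) * (P + 1))) :=
            mul_le_mul_of_nonneg_left (mul_le_mul_of_nonneg_left h2 (by positivity)) hC0
          _ = _ := by ring
      · have h1 : HasDerivAt (fun τ : ℝ => Complex.exp (-z l * τ))
            (Complex.exp (-z l * s) * (-z l)) s := by
          simpa using ((Complex.ofRealCLM.hasDerivAt (x := s)).const_mul (-z l)).cexp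
        have h2 : HasDerivAt v (S *ᵥ v s) s := (hv s hs0.le).hasDerivAt (Ici_mem_nhds hs0)
        have h3 := (φ l).hasFDerivAt.comp_hasDerivAt s ((hobs.hasDerivAt_v j k s hs).sub h2)
        have h4 : HasDerivAt (fun τ => part c (w l j.succ τ)) _ s :=
          (part c).hasFDerivAt.comp_hasDerivAt s (h1.mul h3)
        refine h4.congr_deriv ?_
        -- The middle term `S *ᵥ (vhat - v)` becomes multiplication by `z l` under `φ l` and cancels
        -- the derivative of the rotation.
        have h5 : Shat j.succ s *ᵥ vhat j.succ s
            + μ₂ • ∑ j', A (σ s) j.succ j' • (vhat j' s - vhat j.succ s) - S *ᵥ v s =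
            (Shat j.succ s - S) *ᵥ vhat j.succ s + S *ᵥ (vhat j.succ s - v s) +
            ∑ j', (μ₂ • A (σ s)) j.succ j' •
              ((vhat j' s - v s) - (vhat j.succ s - v s)) := by
          simp only [Matrix.sub_mulVec, Matrix.mulVec_sub, Finset.smul_sum, smul_smul,
            Matrix.smul_apply, smul_eq_mul, sub_sub_sub_cancel_right]
          abel
        have h6 : ∀ j', part c (w l j' s) - part c (w l j.succ s) =
            part c (Complex.exp (-z l * s) *
              φ l ((vhat j' s - v s) - (vhat j.succ s - v s))) := by
          intro j'
          rw [← map_sub, map_sub (φ l), mul_sub]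
        simp only [h6, ← smul_eq_mul (a := (μ₂ • A (σ s)) j.succ _), ← map_smul, ← map_sum]
        rw [← map_add, h5, map_add (φ l), map_add (φ l), hφS, map_sum (φ l)]
        congr 1
        simp only [map_smul, mul_add, Finset.mul_sum,
          mul_smul_comm]
        ring)
  refine ⟨C * (2 * C₂), by positivity, r₂, hr₂, fun j s hs => ?_⟩
  have := hvle j s (C₂ * Real.exp (-r₂ * s)) (fun p => h p j s hs) (by positivity)
  linarith

end IsAdaptiveObserver

theorem lemma1 {N q n₀ : ℕ}
    (S : Matrix (Fin q) (Fin q) ℝ) (hS : HasDistinctImaginaryEigenvalues S)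
    (G : Fin n₀ → Digraph (Fin (N + 1)))
    (A : Fin n₀ → Matrix (Fin (N + 1)) (Fin (N + 1)) ℝ)
    (hA : ∀ p, IsWeightedAdjacency (G p) (A p))
    (σ : ℝ → Fin n₀) (t : ℕ → ℝ) (hσ : IsSwitchingSignal σ t)
    (hG : JointlyConnected G σ t 0)
    (μ₁ μ₂ : ℝ) (hμ₁ : 0 < μ₁) (hμ₂ : 0 < μ₂)
    (v : ℝ → Fin q → ℝ) (hv : IsLeaderTrajectory S v)
    (Shat : Fin (N + 1) → ℝ → Matrix (Fin q) (Fin q) ℝ)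
    (vhat : Fin (N + 1) → ℝ → Fin q → ℝ)
    (hobs : IsAdaptiveObserver S v A σ t μ₁ μ₂ Shat vhat) :
    ExponentiallyTendsToZero (errorS S Shat) ∧ ExponentiallyTendsToZero (errorV v vhat) := by
  constructor
  · obtain ⟨C, hC, r, hr, h⟩ := hobs.exists_exp_bound_errorS hA hσ hG hμ₁
    let L : ((Fin N × Fin q) × Fin q → ℝ) →ₗ[ℝ] Matrix (Fin N × Fin q) (Fin q) ℝ :=
      { toFun := fun g => Matrix.of fun p b => g (p, b)
        map_add' := fun _ _ => rfl
        map_smul' := fun _ _ => rfl }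
    exact exponentiallyTendsToZero_of_coordinates L
      (f := fun s x => (Shat x.1.1.succ s - S) x.1.2 x.2) hC hr
      fun x s hs => h x.1.1.succ x.1.2 x.2 s hs
  · obtain ⟨C, hC, r, hr, h⟩ := hobs.exists_exp_bound_errorV hS hv hA hσ hG hμ₁ hμ₂
    exact exponentiallyTendsToZero_of_coordinates
      (WithLp.linearEquiv 2 ℝ (Fin N × Fin q → ℝ)).symm.toLinearMap
      (f := fun s p => (vhat p.1.succ s - v s) p.2) hC hr
      fun p s hs => (norm_le_pi_norm (vhat p.1.succ s - v s) p.2).trans (h p.1.succ s hs)
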